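/- Let $p$ be a prime, and let $A$ and $B$ be abelian pro-$p$ groups (that is, compact Hausdorff totally disconnected abelian topological groups in which every open subgroup has index a power of $p$), each of which is countably based, meaning that every point has a countable neighbourhood basis. Let $t(B)$ be the torsion subgroup of $B$, i.e. the set of elements of finite order, and suppose that $t(B)$ is of unbounded exponent, i.e. there is no integer $n \ge 1$ such that $x^n = 1$ for all $x \in t(B)$. Then $A$ is isomorphic, as a topological group, to a closed subgroup of the closure $\overline{t(B)}$ of $t(B)$ in $B$. -/

import Mathlib

/-- A topological group is pro-`p` if it is profinite (compact, Hausdorff and totally disconnected)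
and each of its open normal subgroups has index a power of `p`. -/
structure IsProP (p : ℕ) (G : Type*) [Group G] [TopologicalSpace G] [IsTopologicalGroup G] :
    Prop where
  compactSpace : CompactSpace G
  t2Space : T2Space G
  totallyDisconnectedSpace : TotallyDisconnectedSpace G
  index_eq_pow : ∀ N : OpenNormalSubgroup G, ∃ k : ℕ, N.toSubgroup.index = p ^ k

open Topology

/-! Countably many open subgroups `K n` of `A` have cyclic `p`-power quotients and trivial
intersection. Since `t(B)` has unbounded exponent, each `A ⧸ K n` embeds in any prescribed open
subgroup of `B` (`IsProP.exists_hom_ker_eq`). Send it into `U n`, with the `U n` shrinking to `1`,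
so that the product of these maps converges (`exists_continuous_infinite_prod`), and with `U (n +
1)` meeting the `n`-th image trivially, so that no later factor can cancel the first nontrivial one.
Partial products are torsion, so the limit lies in the closure; compactness of `A` makes it a closed
embedding. -/

/-- Open normal subgroups of a first countable profinite group admit a sequence which is
cofinal at the identity. -/
theorem exists_seq_openNormalSubgroup (G : Type*) [Group G] [TopologicalSpace G]
    [IsTopologicalGroup G] [CompactSpace G] [T2Space G] [TotallyDisconnectedSpace G]
    [FirstCountableTopology G] :
    ∃ V : ℕ → OpenNormalSubgroup G, ∀ s ∈ 𝓝 (1 : G), ∃ n, (V n : Set G) ⊆ s := by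
  obtain ⟨s, hs⟩ := (𝓝 (1 : G)).exists_antitone_basis
  have h : ∀ n, ∃ V : OpenNormalSubgroup G, (V : Set G) ⊆ s n := fun n ↦ by
    obtain ⟨V, hV⟩ := ProfiniteGrp.exist_openNormalSubgroup_sub_open_nhds_of_one
      (isOpen_interior (s := s n)) (mem_interior_iff_mem_nhds.2 (hs.1.mem_of_mem trivial))
    exact ⟨V, hV.trans interior_subset⟩
  choose V hV using h
  refine ⟨V, fun t ht ↦ ?_⟩
  obtain ⟨n, -, hn⟩ := hs.1.mem_iff.1 ht
  exact ⟨n, (hV n).trans hn⟩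

/-- An element lying in every member of a family of sets that is cofinal at `1` is `1`. -/
theorem eq_one_of_forall_mem {G ι : Type*} [Group G] [TopologicalSpace G] [T2Space G]
    {V : ι → Set G} (hV : ∀ s ∈ 𝓝 (1 : G), ∃ n, V n ⊆ s) {x : G} (hx : ∀ n, x ∈ V n) :
    x = 1 := by
  by_contra hne
  obtain ⟨n, hn⟩ := hV {x}ᶜ (isOpen_compl_singleton.mem_nhds (by simpa using Ne.symm hne))
  exact hn (hx n) rfl

/-- A finite commutative group has a finite family of subgroups with cyclic quotient and trivial
intersection. -/
theorem exists_finite_cyclic_quotients (G : Type*) [CommGroup G] [Finite G] :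
    ∃ S : Set (Subgroup G), S.Finite ∧ (∀ K ∈ S, IsCyclic (G ⧸ K)) ∧ sInf S = ⊥ := by
  obtain ⟨ι, _, n, -, ⟨e⟩⟩ := CommGroup.equiv_prod_multiplicative_zmod_of_finite G
  let χ : ∀ i, G →* Multiplicative (ZMod (n i)) := fun i ↦
    (Pi.evalMonoidHom _ i).comp e.toMonoidHom
  refine ⟨Set.range fun i ↦ (χ i).ker, Set.finite_range _, ?_, ?_⟩
  · rintro _ ⟨i, rfl⟩
    exact isCyclic_of_injective _ (QuotientGroup.kerLift_injective (χ i))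
  · refine (eq_bot_iff).2 fun x hx ↦ ?_
    rw [Subgroup.mem_sInf] at hx
    refine e.injective (funext fun i ↦ ?_)
    have : χ i x = 1 := hx _ ⟨i, rfl⟩
    simpa [χ] using this

/-- A first countable abelian profinite group has a sequence of open subgroups with cyclic
quotient and trivial intersection. -/
theorem exists_seq_open_cyclic_quotients (A : Type*) [CommGroup A] [TopologicalSpace A]
    [IsTopologicalGroup A] [CompactSpace A] [T2Space A] [TotallyDisconnectedSpace A]
    [FirstCountableTopology A] :
    ∃ K : ℕ → Subgroup A, (∀ n, IsOpen (K n : Set A)) ∧ (∀ n, IsCyclic (A ⧸ K n)) ∧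
      ∀ a, (∀ n, a ∈ K n) → a = 1 := by
  obtain ⟨V, hV⟩ := exists_seq_openNormalSubgroup A
  have hfin : ∀ n, Finite (A ⧸ (V n).toSubgroup) := fun n ↦
    Subgroup.quotient_finite_of_isOpen _ (V n).isOpen'
  choose S hSf hSc hSi using fun n ↦ exists_finite_cyclic_quotients (A ⧸ (V n).toSubgroup)
  -- Adding `⊤` keeps `T` nonempty, hence the range of a sequence.
  let T : Set (Subgroup A) :=
    insert ⊤ (⋃ n, Subgroup.comap (QuotientGroup.mk' (V n).toSubgroup) '' S n)
  have hT : T.Countable :=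
    (Set.countable_iUnion fun n ↦ (hSf n).countable.image _).insert _
  obtain ⟨K, hK⟩ := hT.exists_eq_range ⟨⊤, Set.mem_insert _ _⟩
  have hKT : ∀ n, K n ∈ T := fun n ↦ hK ▸ Set.mem_range_self n
  refine ⟨K, fun n ↦ ?_, fun n ↦ ?_, fun a ha ↦ ?_⟩
  · rcases hKT n with h | h
    · rw [h]; exact isOpen_univ
    · obtain ⟨m, L, -, hL⟩ := Set.mem_iUnion.1 h
      refine Subgroup.isOpen_mono (H₁ := (V m).toSubgroup) ?_ (V m).isOpen'
      rw [← hL]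
      intro x hx
      rw [Subgroup.mem_comap, QuotientGroup.mk'_apply, (QuotientGroup.eq_one_iff x).2 hx]
      exact one_mem _
  · rcases hKT n with h | h
    · rw [h]
      have := QuotientGroup.subsingleton_quotient_top (G := A)
      exact isCyclic_of_subsingleton
    · obtain ⟨m, L, hLS, hL⟩ := Set.mem_iUnion.1 h
      have := hSc m L hLS
      let g := (QuotientGroup.mk' L).comp (QuotientGroup.mk' (V m).toSubgroup)
      have hg : g.ker = K n := by
        rw [← hL, ← MonoidHom.comap_ker, QuotientGroup.ker_mk']
      rw [← hg]
      exact isCyclic_of_injective _ (QuotientGroup.kerLift_injective g)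
  · refine eq_one_of_forall_mem (V := fun n ↦ (V n : Set A)) hV fun n ↦ ?_
    refine (QuotientGroup.eq_one_iff (N := (V n).toSubgroup) a).1 ?_
    rw [← Subgroup.mem_bot, ← hSi n, Subgroup.mem_sInf]
    intro L hL
    have : Subgroup.comap (QuotientGroup.mk' (V n).toSubgroup) L ∈ Set.range K :=
      hK ▸ Or.inr (Set.mem_iUnion.2 ⟨n, L, hL, rfl⟩)
    obtain ⟨k, hk⟩ := this
    have := ha k
    rw [hk] at this
    exact this

/-- Torsion elements of an abelian pro-`p` group have order a power of `p`. -/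
theorem IsProP.exists_orderOf_eq_pow {p : ℕ} (hp : p.Prime) {B : Type*} [CommGroup B]
    [TopologicalSpace B] [IsTopologicalGroup B] (hB : IsProP p B) {x : B}
    (hx : IsOfFinOrder x) : ∃ k, orderOf x = p ^ k := by
  have := hB.compactSpace
  have := hB.t2Space
  have := hB.totallyDisconnectedSpace
  obtain ⟨k, m, hm, h⟩ := Nat.exists_eq_pow_mul_and_not_dvd hx.orderOf_pos.ne' p hp.ne_one
  have hcop : Nat.Coprime m p := ((Nat.Prime.coprime_iff_not_dvd hp).2 hm).symm
  have h1 : x ^ p ^ k = 1 := by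
    refine eq_one_of_forall_mem (V := fun N : OpenNormalSubgroup B ↦ (N : Set B))
      (fun s hs ↦ ?_) fun N ↦ ?_
    · obtain ⟨V, hV⟩ := ProfiniteGrp.exist_openNormalSubgroup_sub_open_nhds_of_one
        (isOpen_interior (s := s)) (mem_interior_iff_mem_nhds.2 hs)
      exact ⟨V, hV.trans interior_subset⟩
    · obtain ⟨l, hl⟩ := hB.index_eq_pow N
      refine (QuotientGroup.eq_one_iff (N := N.toSubgroup) _).1 (orderOf_eq_one_iff.1 ?_)
      refine Nat.eq_one_of_dvd_coprimes (hcop.pow_right l) (orderOf_dvd_of_pow_eq_one ?_)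
        (orderOf_dvd_of_pow_eq_one ?_)
      · rw [← QuotientGroup.mk_pow, ← pow_mul, ← h, pow_orderOf_eq_one]; rfl
      · rw [← hl, Subgroup.index_eq_card]; exact pow_card_eq_one'
  obtain ⟨j, -, hj⟩ := (Nat.dvd_prime_pow hp).1 (orderOf_dvd_of_pow_eq_one h1)
  exact ⟨j, hj⟩

/-- If the torsion of an abelian pro-`p` group has unbounded exponent, then each open subgroup
contains elements of order any given power of `p`. -/
theorem IsProP.exists_mem_orderOf_eq_pow {p : ℕ} (hp : p.Prime) {B : Type*} [CommGroup B]
    [TopologicalSpace B] [IsTopologicalGroup B] (hB : IsProP p B)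
    (ht : ¬ Monoid.ExponentExists (CommGroup.torsion B)) (U : OpenNormalSubgroup B) (m : ℕ) :
    ∃ b ∈ U, orderOf b = p ^ m := by
  obtain ⟨l, hl⟩ := hB.index_eq_pow U
  -- The factor `p ^ l` of the exponent pays for entering `U`; `p ^ m` is the order left over.
  have hx : ∃ x : B, IsOfFinOrder x ∧ x ^ p ^ (l + m) ≠ 1 := by
    by_contra! hcon
    exact ht ⟨p ^ (l + m), pow_pos hp.pos _, fun g ↦ Subtype.ext (hcon g g.2)⟩
  obtain ⟨x, hxf, hx1⟩ := hx
  obtain ⟨k, hk⟩ := hB.exists_orderOf_eq_pow hp hxf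
  have hlk : l + m ≤ k := by
    by_contra! hlt
    exact hx1 (orderOf_dvd_iff_pow_eq_one.1 (hk ▸ pow_dvd_pow p hlt.le))
  refine ⟨x ^ p ^ (k - m), ?_, ?_⟩
  · have hxl : x ^ p ^ l ∈ U.toSubgroup := hl ▸ U.toSubgroup.pow_index_mem x
    have : k - m = l + (k - m - l) := by omega
    rw [this, pow_add, pow_mul]
    exact pow_mem hxl _
  · rw [orderOf_pow_of_dvd (pow_pos hp.pos _).ne' (hk ▸ pow_dvd_pow p (Nat.sub_le k m)), hk,
      Nat.pow_div (Nat.sub_le k m) hp.pos]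
    congr 1
    omega

/-- An open subgroup of an abelian pro-`p` group with cyclic quotient is the kernel of a
homomorphism into the torsion of any prescribed open subgroup of `B`, provided that the torsion
of `B` has unbounded exponent. -/
theorem IsProP.exists_hom_ker_eq {p : ℕ} (hp : p.Prime)
    {A : Type*} [CommGroup A] [TopologicalSpace A] [IsTopologicalGroup A]
    {B : Type*} [CommGroup B] [TopologicalSpace B] [IsTopologicalGroup B]
    (hA : IsProP p A) (hB : IsProP p B) (ht : ¬ Monoid.ExponentExists (CommGroup.torsion B))
    {K : Subgroup A} (hK : IsOpen (K : Set A)) (hKc : IsCyclic (A ⧸ K))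
    (U : OpenNormalSubgroup B) :
    ∃ φ : A →* B, φ.ker = K ∧ (∀ a, φ a ∈ U) ∧ (φ.range : Set B).Finite := by
  obtain ⟨m, hm⟩ := hA.index_eq_pow ⟨⟨K, hK⟩, inferInstance⟩
  obtain ⟨b, hbU, hb⟩ := hB.exists_mem_orderOf_eq_pow hp ht U m
  have hcard : Nat.card (A ⧸ K) = Nat.card (Subgroup.zpowers b) := by
    rw [Nat.card_zpowers, hb]; exact hm
  have hfin : IsOfFinOrder b := orderOf_pos_iff.1 (hb ▸ pow_pos hp.pos m)
  let e := mulEquivOfCyclicCardEq hcard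
  let φ : A →* B := (Subgroup.zpowers b).subtype.comp (e.toMonoidHom.comp (QuotientGroup.mk' K))
  have hφ : ∀ a, φ a ∈ Subgroup.zpowers b := fun a ↦ (e (QuotientGroup.mk' K a)).2
  refine ⟨φ, ?_, fun a ↦ ?_, ?_⟩
  · ext a
    simp [φ, MonoidHom.mem_ker]
  · exact (Subgroup.zpowers_le (H := U.toSubgroup)).2 hbU (hφ a)
  · refine (Set.Finite.subset (s := (Subgroup.zpowers b : Set B)) ?_ ?_)
    · exact finite_zpowers.2 hfin
    · rintro _ ⟨a, rfl⟩
      exact hφ a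

/-- Infinite products of homomorphisms `φ n : A →* B` with open kernel, where `φ n` takes values in
the `n`-th term of a decreasing sequence of open subgroups shrinking to `1`. -/
theorem exists_continuous_infinite_prod
    {A : Type*} [CommGroup A] [TopologicalSpace A] [IsTopologicalGroup A]
    {B : Type*} [CommGroup B] [TopologicalSpace B] [IsTopologicalGroup B]
    [CompactSpace B] [T2Space B] (U : ℕ → OpenNormalSubgroup B) (hU : Antitone U)
    (hUb : ∀ s ∈ 𝓝 (1 : B), ∃ n, (U n : Set B) ⊆ s) (φ : ℕ → A →* B)
    (hφo : ∀ n, IsOpen ((φ n).ker : Set A)) (hφU : ∀ n a, φ n a ∈ U n) :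
    ∃ f : A →* B, Continuous f ∧ ∀ a n, (∏ j ∈ Finset.range n, φ j a)⁻¹ * f a ∈ U n := by
  have hex : ∀ a, ∃ b, ∀ n, (∏ j ∈ Finset.range n, φ j a)⁻¹ * b ∈ U n := fun a ↦ by
    let C : ℕ → Set B := fun n ↦ (fun b ↦ (∏ j ∈ Finset.range n, φ j a)⁻¹ * b) ⁻¹' (U n : Set B)
    have hC : ∀ n, IsClosed (C n) := fun n ↦
      ((U n).toOpenSubgroup.isClosed).preimage (continuous_const_mul _)
    -- The `C n` are nested closed cosets of `U n`, each containing its partial product.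
    have hne : (⋂ n, C n).Nonempty := by
      refine IsCompact.nonempty_iInter_of_sequence_nonempty_isCompact_isClosed C
        (fun n b hb ↦ ?_) (fun n ↦ ⟨∏ j ∈ Finset.range n, φ j a, ?_⟩) (hC 0).isCompact hC
      · have h1 : (∏ j ∈ Finset.range (n + 1), φ j a)⁻¹ * b ∈ U n := hU n.le_succ hb
        have h2 := mul_mem (hφU n a) h1
        rw [Finset.prod_range_succ, mul_inv_rev, mul_assoc, mul_inv_cancel_left] at h2
        exact h2
      · change _ * _ ∈ U n
        rw [inv_mul_cancel]
        exact one_mem _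
    obtain ⟨b, hb⟩ := hne
    exact ⟨b, fun n ↦ Set.mem_iInter.1 hb n⟩
  choose f hf using hex
  have huniq : ∀ a b, (∀ n, (∏ j ∈ Finset.range n, φ j a)⁻¹ * b ∈ U n) → f a = b :=
    fun a b h ↦ by
      refine inv_mul_eq_one.1 (eq_one_of_forall_mem (V := fun n ↦ (U n : Set B)) hUb fun n ↦ ?_)
      have := mul_mem (inv_mem (hf a n)) (h n)
      rwa [mul_inv_rev, inv_inv, mul_assoc, mul_inv_cancel_left] at this
  let F : A →* B := MonoidHom.mk' f fun a b ↦ huniq _ _ fun n ↦ by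
    have := mul_mem (hf a n) (hf b n)
    simp only [map_mul, Finset.prod_mul_distrib, mul_inv]
    rwa [mul_mul_mul_comm] at this
  refine ⟨F, continuous_of_continuousAt_one F ?_, hf⟩
  rw [ContinuousAt, map_one]
  intro s hs
  obtain ⟨n, hn⟩ := hUb s hs
  have hopen : IsOpen (⋂ j ∈ Finset.range n, ((φ j).ker : Set A)) :=
    isOpen_biInter_finset fun j _ ↦ hφo j
  refine Filter.mem_map.2 (Filter.mem_of_superset (hopen.mem_nhds ?_) fun a ha ↦ hn ?_)
  · exact Set.mem_iInter₂.2 fun j _ ↦ one_mem _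
  · have hprod : ∏ j ∈ Finset.range n, φ j a = 1 :=
      Finset.prod_eq_one fun j hj ↦ Set.mem_iInter₂.1 ha j hj
    have := hf a n
    rw [hprod, inv_one, one_mul] at this
    exact this

/-- A first countable abelian pro-`p` group admits an injective continuous homomorphism into the
closure of the torsion of `B`, if that torsion has unbounded exponent. -/
theorem IsProP.exists_injective_hom_closure_torsion {p : ℕ} (hp : p.Prime)
    {A : Type*} [CommGroup A] [TopologicalSpace A] [IsTopologicalGroup A]
    {B : Type*} [CommGroup B] [TopologicalSpace B] [IsTopologicalGroup B]
    (hA : IsProP p A) (hB : IsProP p B)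
    [FirstCountableTopology A] [FirstCountableTopology B]
    (ht : ¬ Monoid.ExponentExists (CommGroup.torsion B)) :
    ∃ f : A →* B, Continuous f ∧ Function.Injective f ∧
      ∀ a, f a ∈ (CommGroup.torsion B).topologicalClosure := by
  have := hA.compactSpace
  have := hA.t2Space
  have := hA.totallyDisconnectedSpace
  have := hB.compactSpace
  have := hB.t2Space
  have := hB.totallyDisconnectedSpace
  obtain ⟨K, hKo, hKc, hK1⟩ := exists_seq_open_cyclic_quotients A
  obtain ⟨V, hV⟩ := exists_seq_openNormalSubgroup B
  have step : ∀ (n : ℕ) (U : OpenNormalSubgroup B), ∃ (φ : A →* B) (U' : OpenNormalSubgroup B),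
      φ.ker = K n ∧ (∀ a, φ a ∈ U) ∧ (φ.range : Set B).Finite ∧ U' ≤ U ∧ U' ≤ V n ∧
      ∀ a, φ a ∈ U' → φ a = 1 := fun n U ↦ by
    obtain ⟨φ, h1, h2, h3⟩ := hA.exists_hom_ker_eq hp hB ht (hKo n) (hKc n) U
    -- The image of `φ` is finite, so some open `W` misses its nontrivial elements.
    obtain ⟨W, hW⟩ := ProfiniteGrp.exist_openNormalSubgroup_sub_open_nhds_of_one
      (U := ((φ.range : Set B) \ {1})ᶜ) (h3.subset Set.sdiff_subset).isClosed.isOpen_compl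
      (by simp)
    refine ⟨φ, U ⊓ V n ⊓ W, h1, h2, h3, inf_le_left.trans inf_le_left,
      inf_le_left.trans inf_le_right, fun a ha ↦ ?_⟩
    by_contra hne
    exact hW ((inf_le_right : U ⊓ V n ⊓ W ≤ W) ha) ⟨⟨a, rfl⟩, hne⟩
  choose Φ U' h1 h2 h3 h4 h5 h6 using step
  let U : ℕ → OpenNormalSubgroup B := fun n ↦ Nat.rec (V 0) (fun n W ↦ U' n W) n
  obtain ⟨f, hfc, hf⟩ := exists_continuous_infinite_prod U
    (antitone_nat_of_succ_le fun n ↦ h4 n (U n))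
    (fun s hs ↦ (hV s hs).imp' Nat.succ fun n hn ↦
      Set.Subset.trans (h5 n (U n) : U (n + 1) ≤ V n) hn)
    (fun n ↦ Φ n (U n)) (fun n ↦ (h1 n (U n)).symm ▸ hKo n) fun n ↦ h2 n (U n)
  refine ⟨f, hfc, (injective_iff_map_eq_one f).2 fun a ha ↦ hK1 a fun n ↦ ?_, fun a ↦ ?_⟩
  · rw [← h1 n (U n), MonoidHom.mem_ker]
    -- Once the earlier factors vanish, `f a = 1` puts the `n`-th factor in `U (n + 1)`, which
    -- forces it to be `1`.
    induction n using Nat.strong_induction_on with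
    | _ n ih =>
      have := inv_mem (hf a (n + 1))
      rw [ha, mul_one, inv_inv, Finset.prod_range_succ,
        Finset.prod_eq_one fun j hj ↦ ih j (Finset.mem_range.1 hj), one_mul] at this
      exact h6 n (U n) a this
  · change f a ∈ closure (CommGroup.torsion B : Set B)
    rw [mem_closure_iff_nhds]
    intro s hs
    -- This map takes the remainder of the product back to the partial product.
    have hs' : (fun x ↦ f a * x⁻¹) ⁻¹' s ∈ 𝓝 (1 : B) :=
      (by fun_prop : Continuous fun x ↦ f a * x⁻¹).continuousAt.preimage_mem_nhds (by simpa)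
    obtain ⟨n, hn⟩ := hV _ hs'
    have hmem := hn (h5 n (U n) (hf a (n + 1)))
    rw [Set.mem_preimage, mul_inv_rev, inv_inv, mul_inv_cancel_left] at hmem
    refine ⟨_, hmem, prod_mem fun j _ ↦ ?_⟩
    have : Finite (Φ j (U j)).range := h3 j (U j)
    exact (Φ j (U j)).range.subtype.isOfFinOrder
      (isOfFinOrder_of_finite (⟨_, a, rfl⟩ : (Φ j (U j)).range))

theorem theorem4p1 (p : ℕ) (hp : p.Prime)
    {A : Type*} [CommGroup A] [TopologicalSpace A] [IsTopologicalGroup A]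
    {B : Type*} [CommGroup B] [TopologicalSpace B] [IsTopologicalGroup B]
    (hA : IsProP p A) (hB : IsProP p B)
    (hAc : FirstCountableTopology A) (hBc : FirstCountableTopology B)
    (ht : ¬ Monoid.ExponentExists (CommGroup.torsion B)) :
    ∃ H : Subgroup (CommGroup.torsion B).topologicalClosure,
      IsClosed (H : Set (CommGroup.torsion B).topologicalClosure) ∧ Nonempty (A ≃ₜ* H) := by
  have := hA.compactSpace
  have := hB.t2Space
  obtain ⟨f, hfc, hfi, hft⟩ := hA.exists_injective_hom_closure_torsion hp hB ht
  let g : A →* (CommGroup.torsion B).topologicalClosure := f.codRestrict _ hft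
  have hgc : Continuous g := hfc.subtype_mk hft
  have hgi : Function.Injective g := fun a b h ↦ hfi (congrArg Subtype.val h)
  let e : A ≃* g.range := MonoidHom.ofInjective hgi
  have hec : Continuous e := hgc.subtype_mk _
  refine ⟨g.range, ?_, ⟨{ e with
    continuous_toFun := hec
    continuous_invFun := (hec.homeoOfEquivCompactToT2 (f := e.toEquiv)).continuous_invFun }⟩⟩
  rw [MonoidHom.coe_range]
  exact (isCompact_range hgc).isClosed
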